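/- All varieties are over $\mathbb{C}$ and irreducible. A Higgs bundle on a smooth projective variety $X$ is a pair $\mathcal{E}=(E,\phi)$ of a holomorphic vector bundle $E$ on $X$ and a holomorphic morphism $\phi\colon E\to E\otimes\Omega^1_X$ with $\phi\wedge\phi=0$. Its pullback along a morphism $f\colon Y\to X$ is $f^*E$ with the Higgs field obtained by composing $f^*\phi\colon f^*E\to f^*E\otimes f^*\Omega^1_X$ with $f^*\Omega^1_X\to\Omega^1_Y$. A Higgs bundle $(E,\phi)$ on a smooth projective curve is semistable if $\deg F/\operatorname{rk}F\le \deg E/\operatorname{rk}E$ for every subsheaf $F\subset E$ with $0<\operatorname{rk}F<\operatorname{rk}E$ and $\phi(F)\subset F\otimes\Omega^1$. The discriminant of a vector bundle $E$ of rank $r>0$ is $\Delta(E)=c_2(E)-\frac{r-1}{2r}c_1(E)^2\in H^4(X,\mathbb{R})$ (and $\Delta(E)=0$ if $r=0$). A smooth projective variety $X$ is called a Higgs variety if either $\dim X=1$, or $\dim X>1$ and $\Delta(E)=0$ for every Higgs bundle $\mathcal{E}=(E,\phi)$ on $X$ such that $f^*\mathcal{E}$ is semistable for every morphism $f\colon C\to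 X$ from a smooth projective curve $C$. **Proposition.** Let $g\colon Y\to X$ be a finite étale map between smooth projective varieties. If $Y$ is a Higgs variety, then so is $X$. -/

import Mathlib

open scoped Manifold ContDiff Topology LinearAlgebra.Projectivization

noncomputable section

namespace HiggsVar

/-! ### Smooth projective varieties -/

section Varieties

/-- The (complex) differential of a map between complex manifolds. In Mathlib the tangent space at a
point of a manifold modelled on `E` is `E` itself, through the preferred chart at that point. -/
def tdiff {E : Type*} [NormedAddCommGroup E] [NormedSpace ℂ E]
    {E' : Type*} [NormedAddCommGroup E'] [NormedSpace ℂ E']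
    {M : Type*} [TopologicalSpace M] [ChartedSpace E M]
    {M' : Type*} [TopologicalSpace M'] [ChartedSpace E' M'] (f : M → M') (x : M) : E →L[ℂ] E' :=
  mfderiv 𝓘(ℂ, E) 𝓘(ℂ, E') f x

/-- A map `Φ : X → ℙ^N` is a holomorphic immersion: near every point it is the class `[u]` of a
holomorphic map `u` to `ℂ^(N+1)` without zeros, and the differential of `[u]` is injective, i.e.
`du(v)` is proportional to `u` only if `v = 0` (the kernel of the differential of
`ℂ^(N+1) ∖ {0} → ℙ^N` at `u` is the line spanned by `u`). -/
def IsProjectiveImmersion (E : Type*) [NormedAddCommGroup E] [NormedSpace ℂ E]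
    {X : Type*} [TopologicalSpace X] [ChartedSpace E X] {N : ℕ}
    (Φ : X → ℙ ℂ (Fin (N + 1) → ℂ)) : Prop :=
  ∀ x : X, ∃ (U : Set X) (u : X → (Fin (N + 1) → ℂ)), IsOpen U ∧ x ∈ U ∧
    ContMDiffOn 𝓘(ℂ, E) 𝓘(ℂ, Fin (N + 1) → ℂ) ω u U ∧
    (∀ y ∈ U, ∃ h : u y ≠ 0, Φ y = Projectivization.mk ℂ (u y) h) ∧
    ∀ v : E, tdiff (E := E) (E' := Fin (N + 1) → ℂ) u x v ∈ Submodule.span ℂ {u x} → v = 0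

/-- `X` is a smooth (irreducible) complex projective variety, seen as a complex manifold modelled on
`E`: a compact connected complex manifold with a holomorphic embedding into some `ℙ^N`.
By Chow's theorem its image is a smooth irreducible projective variety, and the morphisms between
such varieties are the holomorphic maps. -/
class SmoothProjectiveVariety (E : Type*) [NormedAddCommGroup E] [NormedSpace ℂ E]
    (X : Type*) [TopologicalSpace X] [ChartedSpace E X] : Prop where
  finiteDimensional : FiniteDimensional ℂ E
  isManifold : IsManifold 𝓘(ℂ, E) ω X
  t2Space : T2Space X
  compactSpace : CompactSpace X
  connectedSpace : ConnectedSpace X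
  exists_embedding : ∃ (N : ℕ) (Φ : X → ℙ ℂ (Fin (N + 1) → ℂ)),
    Function.Injective Φ ∧ IsProjectiveImmersion E Φ

variable {E : Type*} [NormedAddCommGroup E] [NormedSpace ℂ E]
  {X : Type*} [TopologicalSpace X] [ChartedSpace E X]
  {E' : Type*} [NormedAddCommGroup E'] [NormedSpace ℂ E']
  {Y : Type*} [TopologicalSpace Y] [ChartedSpace E' Y]

/-- Morphisms of smooth projective varieties: holomorphic maps. -/
def IsMorphism (E : Type*) [NormedAddCommGroup E] [NormedSpace ℂ E]
    {X : Type*} [TopologicalSpace X] [ChartedSpace E X]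
    (E' : Type*) [NormedAddCommGroup E'] [NormedSpace ℂ E']
    {Y : Type*} [TopologicalSpace Y] [ChartedSpace E' Y] (f : X → Y) : Prop :=
  ContMDiff 𝓘(ℂ, E) 𝓘(ℂ, E') ω f

/-- Finite étale morphisms: morphisms which are étale (locally biholomorphic) and finite (proper with
finite fibres). -/
structure IsFiniteEtale (E : Type*) [NormedAddCommGroup E] [NormedSpace ℂ E]
    {X : Type*} [TopologicalSpace X] [ChartedSpace E X]
    (E' : Type*) [NormedAddCommGroup E'] [NormedSpace ℂ E']
    {Y : Type*} [TopologicalSpace Y] [ChartedSpace E' Y] (f : X → Y) : Prop where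
  isMorphism : IsMorphism E E' f
  etale : IsLocalDiffeomorph 𝓘(ℂ, E) 𝓘(ℂ, E') ω f
  proper : IsProperMap f
  finite_fibres : ∀ y, (f ⁻¹' {y}).Finite

end Varieties

/-! ### Holomorphic vector bundles and Higgs bundles -/

section Higgs

/-- The model fibre of a vector bundle of rank `r`. -/
abbrev Fib (r : ℕ) := Fin r → ℂ

/-- Endomorphisms of the model fibre. -/
abbrev EndFib (r : ℕ) := Fib r →L[ℂ] Fib r

/-- A one-form of type `(1,0)` on `X` with values in `V`, read in the preferred chart at `p`. -/
def holFormInChart {E : Type*} [NormedAddCommGroup E] [NormedSpace ℂ E]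
    {X : Type*} [TopologicalSpace X] [ChartedSpace E X]
    {V : Type*} [NormedAddCommGroup V] [NormedSpace ℂ V]
    (α : X → E →L[ℂ] V) (p : X) (y : E) : E →L[ℂ] V :=
  (α ((chartAt E p).symm y)).comp (tdiff (E := E) (E' := E) (chartAt E p).symm y)

variable (E : Type*) [NormedAddCommGroup E] [NormedSpace ℂ E]
  (X : Type*) [TopologicalSpace X] [ChartedSpace E X]

/-- A holomorphic vector bundle of rank `r` on `X`, given by a holomorphic cocycle on an open cover.
If `s_i` are the coordinates of a section over `U_i = core.baseSet i`, then
`s_j = (core.coordChange i j) s_i` on `U_i ∩ U_j`. -/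
structure HolBundle (r : ℕ) where
  ι : Type
  core : VectorBundleCore ℂ X (Fib r) ι
  holomorphic : core.IsContMDiff 𝓘(ℂ, E) ω

/-- A Higgs bundle `(B, φ)` of rank `r`: a holomorphic vector bundle `B` with a holomorphic morphism
`φ : B → B ⊗ Ω¹`, i.e. a holomorphic one-form with values in `End B`, such that `φ ∧ φ = 0`.
`φ i` is the matrix of `φ` in the trivialization over `U_i`. -/
structure HiggsBundle (r : ℕ) extends HolBundle E X r where
  φ : ι → X → E →L[ℂ] EndFib r
  φ_holomorphic : ∀ (i : ι) (p : X), ContDiffOn ℂ ω (holFormInChart (φ i) p)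
    ((chartAt E p).target ∩ (chartAt E p).symm ⁻¹' core.baseSet i)
  φ_glue : ∀ (i j : ι), ∀ x ∈ core.baseSet i ∩ core.baseSet j, ∀ v : E,
    (φ j x v).comp (core.coordChange i j x) = (core.coordChange i j x).comp (φ i x v)
  φ_wedge_φ : ∀ (i : ι), ∀ x ∈ core.baseSet i, ∀ v w : E,
    (φ i x v).comp (φ i x w) = (φ i x w).comp (φ i x v)

variable {E X} {E' : Type*} [NormedAddCommGroup E'] [NormedSpace ℂ E']
  {Y : Type*} [TopologicalSpace Y] [ChartedSpace E' Y]

/-- The pullback of a holomorphic vector bundle along a morphism `f : Y → X`. -/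
def HolBundle.pullback {r : ℕ} (B : HolBundle E X r) (f : Y → X) (hf : IsMorphism E' E f) :
    HolBundle E' Y r where
  ι := B.ι
  core :=
    { baseSet := fun i => f ⁻¹' B.core.baseSet i
      isOpen_baseSet := fun i => (B.core.isOpen_baseSet i).preimage hf.continuous
      indexAt := fun y => B.core.indexAt (f y)
      mem_baseSet_at := fun y => B.core.mem_baseSet_at (f y)
      coordChange := fun i j y => B.core.coordChange i j (f y)
      coordChange_self := fun i y hy v => B.core.coordChange_self i (f y) hy v
      continuousOn_coordChange := fun i j =>
        (B.core.continuousOn_coordChange i j).comp hf.continuous.continuousOn fun _ hy => hy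
      coordChange_comp := fun i j k y hy v => B.core.coordChange_comp i j k (f y) hy v }
  holomorphic := ⟨fun i j =>
    (B.holomorphic.contMDiffOn_coordChange i j).comp hf.contMDiffOn fun _ hy => hy⟩

/-- Change of variables for one-forms: the pullback by `f` of a one-form, read in a chart. -/
theorem holFormInChart_pullback [IsManifold 𝓘(ℂ, E) ω X] [IsManifold 𝓘(ℂ, E') ω Y]
    {V : Type*} [NormedAddCommGroup V] [NormedSpace ℂ V]
    (α : X → E →L[ℂ] V) {f : Y → X} (hf : IsMorphism E' E f) {U : Set X} (hU : IsOpen U)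
    (hα : ∀ p : X, ContDiffOn ℂ ω (holFormInChart α p)
      ((chartAt E p).target ∩ (chartAt E p).symm ⁻¹' U)) (q : Y) :
    ContDiffOn ℂ ω (holFormInChart (fun y => (α (f y)).comp (tdiff (E := E') (E' := E) f y)) q)
      ((chartAt E' q).target ∩ (chartAt E' q).symm ⁻¹' (f ⁻¹' U)) := by
  rintro z₀ ⟨hz₀, hz₀U⟩
  apply ContDiffAt.contDiffWithinAt
  set e := chartAt E' q with he
  set e' := chartAt E (f (e.symm z₀)) with he'
  let τ : E' → E := fun z => e' (f (e.symm z))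
  have hsymm : ContMDiffOn 𝓘(ℂ, E') 𝓘(ℂ, E') ω e.symm e.target := contMDiffOn_chart_symm
  have hfe : ContMDiffOn 𝓘(ℂ, E') 𝓘(ℂ, E) ω (fun z => f (e.symm z)) e.target :=
    hf.comp_contMDiffOn hsymm
  have hnhds : e.target ∈ 𝓝 z₀ := e.open_target.mem_nhds hz₀
  have hfe₀ : ContMDiffAt 𝓘(ℂ, E') 𝓘(ℂ, E) ω (fun z => f (e.symm z)) z₀ :=
    (hfe z₀ hz₀).contMDiffAt hnhds
  have hsrc : f (e.symm z₀) ∈ e'.source := mem_chart_source E _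
  have hτ : ContDiffAt ℂ ω τ z₀ := by
    rw [← contMDiffAt_iff_contDiffAt]
    exact (((contMDiffOn_chart (I := 𝓘(ℂ, E)) (n := ω) (x := f (e.symm z₀))) _ hsrc).contMDiffAt
      (e'.open_source.mem_nhds hsrc)).comp z₀ hfe₀
  have hev : ∀ᶠ z in 𝓝 z₀, z ∈ e.target ∧ f (e.symm z) ∈ e'.source :=
    (e.open_target.eventually_mem hz₀).and
      (hfe₀.continuousAt.eventually_mem (e'.open_source.mem_nhds hsrc))
  have key : ∀ᶠ z in 𝓝 z₀,
      holFormInChart (fun y => (α (f y)).comp (tdiff (E := E') (E' := E) f y)) q z =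
        (holFormInChart α (f (e.symm z₀)) (τ z)).comp (fderiv ℂ τ z) := by
    filter_upwards [hev.eventually_nhds] with z hz
    obtain ⟨hzt, hzs⟩ := hz.self_of_nhds
    have hτz : e'.symm (τ z) = f (e.symm z) := e'.left_inv hzs
    have hloc : (fun w => f (e.symm w)) =ᶠ[𝓝 z] fun w => e'.symm (τ w) := by
      filter_upwards [hz] with w hw
      exact (e'.left_inv hw.2).symm
    have hd1 : MDifferentiableAt 𝓘(ℂ, E') 𝓘(ℂ, E') e.symm z :=
      ((hsymm z hzt).contMDiffAt (e.open_target.mem_nhds hzt)).mdifferentiableAt (by simp)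
    have hd2 : MDifferentiableAt 𝓘(ℂ, E') 𝓘(ℂ, E) f (e.symm z) :=
      hf.contMDiffAt.mdifferentiableAt (by simp)
    have hd3 : MDifferentiableAt 𝓘(ℂ, E) 𝓘(ℂ, E) e'.symm (τ z) :=
      ((contMDiffOn_chart_symm (I := 𝓘(ℂ, E)) (n := ω) (x := f (e.symm z₀)) _
        (e'.map_source hzs)).contMDiffAt
          (e'.open_target.mem_nhds (e'.map_source hzs))).mdifferentiableAt (by simp)
    have hd4 : MDifferentiableAt 𝓘(ℂ, E') 𝓘(ℂ, E) τ z := by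
      have h1 : MDifferentiableAt 𝓘(ℂ, E) 𝓘(ℂ, E) e' (f (e.symm z)) :=
        ((contMDiffOn_chart (I := 𝓘(ℂ, E)) (n := ω) (x := f (e.symm z₀)) _ hzs).contMDiffAt
          (e'.open_source.mem_nhds hzs)).mdifferentiableAt (by simp)
      exact h1.comp z (hd2.comp z hd1)
    have hchain : (tdiff (E := E') (E' := E) f (e.symm z)).comp
          (tdiff (E := E') (E' := E') e.symm z) =
        (tdiff (E := E) (E' := E) e'.symm (τ z)).comp (fderiv ℂ τ z) := by
      have h1 := mfderiv_comp z hd2 hd1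
      have h2 := mfderiv_comp z hd3 hd4
      have h3 := hloc.mfderiv_eq (I := 𝓘(ℂ, E')) (I' := 𝓘(ℂ, E))
      rw [mfderiv_eq_fderiv] at h2
      exact h1.symm.trans (h3.trans h2)
    simp only [holFormInChart]
    rw [← he', hτz, ContinuousLinearMap.comp_assoc, hchain, ContinuousLinearMap.comp_assoc]
  refine ContDiffAt.congr_of_eventuallyEq ?_ key
  have hmem : τ z₀ ∈ e'.target ∩ e'.symm ⁻¹' U :=
    ⟨e'.map_source hsrc, by
      change e'.symm (e' (f (e.symm z₀))) ∈ U
      rw [e'.left_inv hsrc]; exact hz₀U⟩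
  have hα₀ : ContDiffAt ℂ ω (holFormInChart α (f (e.symm z₀))) (τ z₀) :=
    (hα _ _ hmem).contDiffAt ((e'.isOpen_inter_preimage_symm hU).mem_nhds hmem)
  exact (hα₀.comp z₀ hτ).clm_comp (hτ.fderiv_right (m := ω) (by simp))

/-- The pullback of a Higgs bundle `(B, φ)` along a morphism `f : Y → X`: the bundle `f^* B`, with the
Higgs field `f^* B → f^* B ⊗ f^* Ω¹_X → f^* B ⊗ Ω¹_Y`. -/
def HiggsBundle.pullback [IsManifold 𝓘(ℂ, E) ω X] [IsManifold 𝓘(ℂ, E') ω Y] {r : ℕ}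
    (H : HiggsBundle E X r) (f : Y → X) (hf : IsMorphism E' E f) : HiggsBundle E' Y r where
  toHolBundle := H.toHolBundle.pullback f hf
  φ := fun i y => (H.φ i (f y)).comp (tdiff (E := E') (E' := E) f y)
  φ_holomorphic := fun i q =>
    holFormInChart_pullback (H.φ i) hf (H.core.isOpen_baseSet i) (H.φ_holomorphic i) q
  φ_glue := fun i j y hy _ => H.φ_glue i j (f y) hy _
  φ_wedge_φ := fun i y hy _ _ => H.φ_wedge_φ i (f y) hy _ _

end Higgs

/-! ### Degree and semistability on curves -/

section Curves

variable {C : Type*} [TopologicalSpace C] [ChartedSpace ℂ C]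

/-- A meromorphic section, not identically zero near any point, of the determinant line bundle of `B`
on a curve. Its coordinates satisfy `s_j = det (g_ij) s_i`. -/
structure HolBundle.DetSection {r : ℕ} (B : HolBundle ℂ C r) where
  s : B.ι → C → ℂ
  meromorphic : ∀ i, ∀ p ∈ B.core.baseSet i,
    MeromorphicAt (s i ∘ (chartAt ℂ p).symm) (chartAt ℂ p p)
  ne_zero : ∀ i, ∀ p ∈ B.core.baseSet i,
    meromorphicOrderAt (s i ∘ (chartAt ℂ p).symm) (chartAt ℂ p p) ≠ ⊤
  glue : ∀ i j, ∀ p ∈ B.core.baseSet i ∩ B.core.baseSet j,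
    s j p = (B.core.coordChange i j p).det * s i p

/-- The degree of the divisor of a meromorphic section of `det B`: the number of its zeros minus the
number of its poles, with multiplicities. -/
def HolBundle.DetSection.divisorDegree {r : ℕ} {B : HolBundle ℂ C r} (σ : B.DetSection) : ℤ :=
  ∑ᶠ p : C, (meromorphicOrderAt (σ.s (B.core.indexAt p) ∘ (chartAt ℂ p).symm) (chartAt ℂ p p)).untop₀

open Classical in
/-- The degree of a vector bundle on a smooth projective curve: the degree of the divisor of a nonzero
meromorphic section of `det B`. Such a section always exists and the degree does not depend on it. -/
def HolBundle.degree {r : ℕ} (B : HolBundle ℂ C r) : ℤ :=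
  if h : Nonempty B.DetSection then h.some.divisorDegree else 0

/-- The slope `deg B / rk B`. -/
def HolBundle.slope {r : ℕ} (B : HolBundle ℂ C r) : ℚ :=
  (B.degree : ℚ) / (r : ℚ)

/-- An injective morphism of sheaves `u : G → H` between the sheaves of sections of two bundles on a
curve (injective on the fibres over a dense set, not necessarily on all fibres) under which the Higgs
field `ψ` of `G` is the restriction of the Higgs field `φ` of `H`: `φ ∘ u = (u ⊗ 1) ∘ ψ`. -/
structure HiggsBundle.SubsheafInclusion {s r : ℕ} (G : HiggsBundle ℂ C s)
    (H : HiggsBundle ℂ C r) where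
  u : G.ι → H.ι → C → (Fib s →L[ℂ] Fib r)
  holomorphic : ∀ a b, ContMDiffOn 𝓘(ℂ, ℂ) 𝓘(ℂ, Fib s →L[ℂ] Fib r) ω (u a b)
    (G.core.baseSet a ∩ H.core.baseSet b)
  glue : ∀ a a' b b', ∀ x ∈ (G.core.baseSet a ∩ G.core.baseSet a') ∩
      (H.core.baseSet b ∩ H.core.baseSet b'),
    (H.core.coordChange b b' x).comp (u a b x) = (u a' b' x).comp (G.core.coordChange a a' x)
  injective : Dense {x | Function.Injective (u (G.core.indexAt x) (H.core.indexAt x) x)}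
  compat : ∀ a b, ∀ x ∈ G.core.baseSet a ∩ H.core.baseSet b, ∀ v : ℂ,
    (H.φ b x v).comp (u a b x) = (u a b x).comp (G.φ a x v)

/-- Semistability of a Higgs bundle on a smooth projective curve: every `φ`-invariant subsheaf `G` with
`0 < rk G < rk H` has slope at most that of `H`. On a smooth curve the subsheaves of a vector bundle
are exactly the locally free ones, and a `φ`-invariant one carries the restricted Higgs field. -/
def HiggsBundle.IsSemistable {r : ℕ} (H : HiggsBundle ℂ C r) : Prop :=
  ∀ (s : ℕ) (G : HiggsBundle ℂ C s), 0 < s → s < r → Nonempty (G.SubsheafInclusion H) →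
    G.toHolBundle.slope ≤ H.toHolBundle.slope

end Curves

/-! ### Real de Rham classes and the discriminant -/

section Chern

variable {E : Type*} [NormedAddCommGroup E] [NormedSpace ℂ E]
  {X : Type*} [TopologicalSpace X] [ChartedSpace E X]

/-- The real differential at `y` of the inverse of the preferred chart at `p`. -/
def chartSymmDiff (p : X) (y : E) : E →L[ℝ] E :=
  (tdiff (E := E) (E' := E) (chartAt E p).symm y).restrictScalars ℝ

/-- A one-form with values in a real vector space, read in the preferred chart at `p`. -/
def oneFormInChart {V : Type*} [NormedAddCommGroup V] [NormedSpace ℝ V]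
    (α : X → E →L[ℝ] V) (p : X) (y : E) : E →L[ℝ] V :=
  (α ((chartAt E p).symm y)).comp (chartSymmDiff p y)

/-- A real differential `k`-form, read in the preferred chart at `p`. -/
def formInChart {k : ℕ} (η : X → E [⋀^Fin k]→L[ℝ] ℝ) (p : X) (y : E) : E [⋀^Fin k]→L[ℝ] ℝ :=
  (η ((chartAt E p).symm y)).compContinuousLinearMap (chartSymmDiff p y)

/-- Smoothness (in the real sense) of a differential form. -/
def IsSmoothForm {k : ℕ} (η : X → E [⋀^Fin k]→L[ℝ] ℝ) : Prop :=
  ∀ p : X, ContDiffOn ℝ ∞ (formInChart η p) (chartAt E p).target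

/-- The exterior derivative of a differential form. -/
def extD {k : ℕ} (η : X → E [⋀^Fin k]→L[ℝ] ℝ) (p : X) : E [⋀^Fin (k + 1)]→L[ℝ] ℝ :=
  extDeriv (formInChart η p) (chartAt E p p)

/-- The real 4-form `Ω` is exact: its class in `H⁴(X, ℝ)` (de Rham cohomology) is zero. -/
def IsExactFourForm (Ω : X → (Fin 4 → E) → ℝ) : Prop :=
  ∃ η : X → E [⋀^Fin 3]→L[ℝ] ℝ, IsSmoothForm η ∧ ∀ p v, extD η p v = Ω p v

/-- The wedge product of two 2-forms with values in a ring. -/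
def wedge {A : Type*} [Ring A] (α β : E → E → A) (v : Fin 4 → E) : A :=
  α (v 0) (v 1) * β (v 2) (v 3) - α (v 0) (v 2) * β (v 1) (v 3) + α (v 0) (v 3) * β (v 1) (v 2)
    + α (v 1) (v 2) * β (v 0) (v 3) - α (v 1) (v 3) * β (v 0) (v 2) + α (v 2) (v 3) * β (v 0) (v 1)

/-- The trace of an endomorphism of the model fibre. -/
def tr {r : ℕ} (T : EndFib r) : ℂ := LinearMap.trace ℂ (Fib r) T.toLinearMap

/-- A smooth complex connection on the bundle `B`: over `U_i` it is `d + A_i`. The gluing law says that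
`(d + A_j) (g s) = g (d + A_i) s` for `g = core.coordChange i j`. -/
structure HolBundle.Connection {r : ℕ} (B : HolBundle E X r) where
  A : B.ι → X → E →L[ℝ] EndFib r
  smooth : ∀ (i : B.ι) (p : X), ContDiffOn ℝ ∞ (oneFormInChart (A i) p)
    ((chartAt E p).target ∩ (chartAt E p).symm ⁻¹' B.core.baseSet i)
  glue : ∀ (i j : B.ι), ∀ x ∈ B.core.baseSet i ∩ B.core.baseSet j, ∀ v : E,
    tdiff (E := E) (E' := EndFib r) (B.core.coordChange i j) x v
        + (A j x v).comp (B.core.coordChange i j x) =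
      (B.core.coordChange i j x).comp (A i x v)

namespace HolBundle.Connection

variable {r : ℕ} {B : HolBundle E X r} (D : B.Connection)

/-- The curvature `dA + A ∧ A` at `p`, in a trivialization around `p`. -/
def curvature (p : X) (v w : E) : EndFib r :=
  let a : E → E →L[ℝ] EndFib r := oneFormInChart (D.A (B.core.indexAt p)) p
  let y : E := chartAt E p p
  fderiv ℝ a y v w - fderiv ℝ a y w v + (a y v * a y w - a y w * a y v)

/-- The first Chern form `(i / 2π) tr F`. The real part is taken because the connection need not be
unitary: the imaginary part of a Chern form is always exact, so that the real part represents the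
Chern class in real cohomology. -/
def c₁ (p : X) (v w : E) : ℝ :=
  (Complex.I / (2 * Real.pi) * tr (D.curvature p v w)).re

/-- The second Chern form `(1 / 8π²) (tr (F ∧ F) - tr F ∧ tr F)` (its real part, as for `c₁`). -/
def c₂ (p : X) (v : Fin 4 → E) : ℝ :=
  (1 / (8 * (Real.pi : ℂ) ^ 2) * (tr (wedge (D.curvature p) (D.curvature p) v)
    - wedge (fun a b => tr (D.curvature p a b)) (fun a b => tr (D.curvature p a b)) v)).re

/-- The form `c₂ - ((r - 1) / 2r) c₁ ∧ c₁`, which represents the discriminant `Δ(B)`. -/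
def discriminantForm (p : X) (v : Fin 4 → E) : ℝ :=
  D.c₂ p v - ((r : ℝ) - 1) / (2 * r) * wedge (D.c₁ p) (D.c₁ p) v

end HolBundle.Connection

/-- `Δ(B) = 0` in `H⁴(X, ℝ)`, with the Chern classes defined by Chern-Weil theory. A connection exists
on every bundle over a compact manifold, and the class of `discriminantForm` does not depend on it. -/
def HolBundle.DiscriminantVanishes {r : ℕ} (B : HolBundle E X r) : Prop :=
  ∀ D : B.Connection, IsExactFourForm D.discriminantForm

end Chern

/-! ### Higgs varieties -/

attribute [instance] SmoothProjectiveVariety.isManifold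

/-- `X` is a Higgs variety if `dim X = 1`, or if `dim X > 1` and `Δ(B) = 0` for every Higgs bundle
`(B, φ)` on `X` whose pullbacks to all smooth projective curves are semistable Higgs bundles. -/
def IsHiggsVariety (E : Type*) [NormedAddCommGroup E] [NormedSpace ℂ E]
    (X : Type*) [TopologicalSpace X] [ChartedSpace E X] [SmoothProjectiveVariety E X] : Prop :=
  Module.finrank ℂ E = 1 ∨
    (1 < Module.finrank ℂ E ∧ ∀ (r : ℕ) (H : HiggsBundle E X r),
      (∀ (C : Type) [TopologicalSpace C] [ChartedSpace ℂ C] [SmoothProjectiveVariety ℂ C]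
        (f : C → X) (hf : IsMorphism ℂ E f), (H.pullback f hf).IsSemistable) →
      H.toHolBundle.DiscriminantVanishes)

end HiggsVar

end

/-! The discriminant of a pulled-back bundle is the pullback of the discriminant, and pullback along
a finite étale map is injective on real cohomology. Let H be a Higgs bundle on X that is semistable
on all curves. A curve f in Y gives the curve g ∘ f in X, and f^*(g^*H) = (g ∘ f)^*H
(`HiggsBundle.pullback_pullback`). So g^*H satisfies the hypothesis on Y, and its discriminant
vanishes there.

To descend this, fix a connection D on H. The curvature of g^*D is the pullback of the curvature of
D (`curvature_pullback`), so the discriminant form of g^*D is g^*Ω, with Ω that of D. Hence g^*Ω =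
dη for some 3-form η on Y. Since g is a covering with finite nonempty fibres, η can be averaged over
the sheets. Locally the average is (1/n) ∑ s_i^*η for the holomorphic sections s_i of g, and its
derivative is (1/n) ∑ s_i^*g^*Ω = Ω, because g ∘ s_i = id (`isExactFourForm_of_pullback`). So Ω is
exact. Only division by n, possible with real coefficients, is needed. -/

namespace HiggsVar

/-! ### Pullback of real forms along holomorphic maps, in charts -/

section LocalRepresentative

variable {E : Type*} [NormedAddCommGroup E] [NormedSpace ℂ E]
  {X : Type*} [TopologicalSpace X] [ChartedSpace E X]
  {E' : Type*} [NormedAddCommGroup E'] [NormedSpace ℂ E']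
  {Y : Type*} [TopologicalSpace Y] [ChartedSpace E' Y]

/-- The map `f` read in the preferred charts at `q` and `p`. -/
noncomputable def localRep (E : Type*) [NormedAddCommGroup E] [NormedSpace ℂ E]
    {X : Type*} [TopologicalSpace X] [ChartedSpace E X]
    (E' : Type*) [NormedAddCommGroup E'] [NormedSpace ℂ E']
    {Y : Type*} [TopologicalSpace Y] [ChartedSpace E' Y]
    (f : Y → X) (q : Y) (p : X) (z : E') : E :=
  chartAt E p (f ((chartAt E' q).symm z))

/-- The pullback of a real one-form along a holomorphic map. -/
noncomputable def pullOneForm {V : Type*} [NormedAddCommGroup V] [NormedSpace ℝ V]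
    (f : Y → X) (α : X → E →L[ℝ] V) (y : Y) : E' →L[ℝ] V :=
  (α (f y)).comp ((tdiff (E := E') (E' := E) f y).restrictScalars ℝ)

/-- The pullback of a real differential form along a holomorphic map. -/
noncomputable def pullForm {k : ℕ} (f : Y → X) (η : X → E [⋀^Fin k]→L[ℝ] ℝ) (y : Y) :
    E' [⋀^Fin k]→L[ℝ] ℝ :=
  (η (f y)).compContinuousLinearMap ((tdiff (E := E') (E' := E) f y).restrictScalars ℝ)

variable {f : Y → X} {U : Set Y} {q : Y} {p : X} {z₀ : E'}

theorem eventually_localRep (hU : IsOpen U) (hf : ContMDiffOn 𝓘(ℂ, E') 𝓘(ℂ, E) ω f U)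
    (hz₀ : z₀ ∈ (chartAt E' q).target) (hz₀U : (chartAt E' q).symm z₀ ∈ U)
    (hp : f ((chartAt E' q).symm z₀) ∈ (chartAt E p).source) :
    ∀ᶠ z in 𝓝 z₀, z ∈ (chartAt E' q).target ∧ (chartAt E' q).symm z ∈ U ∧
      f ((chartAt E' q).symm z) ∈ (chartAt E p).source := by
  have hc : ContinuousAt (chartAt E' q).symm z₀ := (chartAt E' q).continuousAt_symm hz₀
  have hfc : ContinuousAt (fun z => f ((chartAt E' q).symm z)) z₀ :=
    ContinuousAt.comp (g := f) ((hf.continuousOn).continuousAt (hU.mem_nhds hz₀U)) hc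
  exact ((chartAt E' q).open_target.eventually_mem hz₀).and
    ((hc.eventually_mem (hU.mem_nhds hz₀U)).and
      (hfc.eventually_mem ((chartAt E p).open_source.mem_nhds hp)))

variable [IsManifold 𝓘(ℂ, E) ω X] [IsManifold 𝓘(ℂ, E') ω Y]

theorem contDiffAt_localRep (hU : IsOpen U) (hf : ContMDiffOn 𝓘(ℂ, E') 𝓘(ℂ, E) ω f U)
    (hz₀ : z₀ ∈ (chartAt E' q).target) (hz₀U : (chartAt E' q).symm z₀ ∈ U)
    (hp : f ((chartAt E' q).symm z₀) ∈ (chartAt E p).source) :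
    ContDiffAt ℂ ω (localRep E E' f q p) z₀ := by
  have hsymm : ContMDiffAt 𝓘(ℂ, E') 𝓘(ℂ, E') ω (chartAt E' q).symm z₀ :=
    (contMDiffOn_chart_symm z₀ hz₀).contMDiffAt ((chartAt E' q).open_target.mem_nhds hz₀)
  have hfe : ContMDiffAt 𝓘(ℂ, E') 𝓘(ℂ, E) ω (fun z => f ((chartAt E' q).symm z)) z₀ :=
    ((hf _ hz₀U).contMDiffAt (hU.mem_nhds hz₀U)).comp z₀ hsymm
  rw [← contMDiffAt_iff_contDiffAt]
  exact ((contMDiffOn_chart (I := 𝓘(ℂ, E)) (n := ω) (x := p) _ hp).contMDiffAt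
    ((chartAt E p).open_source.mem_nhds hp)).comp z₀ hfe

theorem contDiffAt_real_localRep (hU : IsOpen U) (hf : ContMDiffOn 𝓘(ℂ, E') 𝓘(ℂ, E) ω f U)
    (hz₀ : z₀ ∈ (chartAt E' q).target) (hz₀U : (chartAt E' q).symm z₀ ∈ U)
    (hp : f ((chartAt E' q).symm z₀) ∈ (chartAt E p).source) :
    ContDiffAt ℝ ∞ (localRep E E' f q p) z₀ :=
  ((contDiffAt_localRep hU hf hz₀ hz₀U hp).restrict_scalars ℝ).of_le le_top

/-- Chain rule applied to the two factorizations of one map: near `z₀`, `f` after the inverse chart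
at `q` equals the inverse chart at `p` after the local representative. The derivatives are first
compared over ℂ, then restricted to ℝ. -/
theorem tdiff_comp_chartSymmDiff (hU : IsOpen U) (hf : ContMDiffOn 𝓘(ℂ, E') 𝓘(ℂ, E) ω f U)
    (hz₀ : z₀ ∈ (chartAt E' q).target) (hz₀U : (chartAt E' q).symm z₀ ∈ U)
    (hp : f ((chartAt E' q).symm z₀) ∈ (chartAt E p).source) :
    ((tdiff (E := E') (E' := E) f ((chartAt E' q).symm z₀)).restrictScalars ℝ).comp
        (chartSymmDiff q z₀) =
      (chartSymmDiff p (localRep E E' f q p z₀)).comp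
        (fderiv ℝ (localRep E E' f q p) z₀) := by
  have hsymm : MDifferentiableAt 𝓘(ℂ, E') 𝓘(ℂ, E') (chartAt E' q).symm z₀ :=
    ((contMDiffOn_chart_symm (n := ω) z₀ hz₀).contMDiffAt
      ((chartAt E' q).open_target.mem_nhds hz₀)).mdifferentiableAt (by simp)
  have hfd : MDifferentiableAt 𝓘(ℂ, E') 𝓘(ℂ, E) f ((chartAt E' q).symm z₀) :=
    ((hf _ hz₀U).contMDiffAt (hU.mem_nhds hz₀U)).mdifferentiableAt (by simp)
  have hsymm' : MDifferentiableAt 𝓘(ℂ, E) 𝓘(ℂ, E) (chartAt E p).symm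
      (localRep E E' f q p z₀) :=
    ((contMDiffOn_chart_symm (I := 𝓘(ℂ, E)) (n := ω) (x := p) _
      ((chartAt E p).map_source hp)).contMDiffAt
        ((chartAt E p).open_target.mem_nhds ((chartAt E p).map_source hp))).mdifferentiableAt
          (by simp)
  have hrep : DifferentiableAt ℂ (localRep E E' f q p) z₀ :=
    (contDiffAt_localRep hU hf hz₀ hz₀U hp).differentiableAt (by simp)
  have hloc : (fun w => f ((chartAt E' q).symm w)) =ᶠ[𝓝 z₀]
      fun w => (chartAt E p).symm (localRep E E' f q p w) := by
    filter_upwards [eventually_localRep hU hf hz₀ hz₀U hp] with w hw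
    exact ((chartAt E p).left_inv hw.2.2).symm
  have h1 := mfderiv_comp z₀ hfd hsymm
  have h2 := mfderiv_comp z₀ hsymm' hrep.mdifferentiableAt
  have h3 := hloc.mfderiv_eq (I := 𝓘(ℂ, E')) (I' := 𝓘(ℂ, E))
  rw [mfderiv_eq_fderiv] at h2
  have h4 := h1.symm.trans (h3.trans h2)
  rw [hrep.fderiv_restrictScalars ℝ]
  ext v
  exact DFunLike.congr_fun h4 v

theorem oneFormInChart_pullOneForm {V : Type*} [NormedAddCommGroup V] [NormedSpace ℝ V]
    (α : X → E →L[ℝ] V) (hU : IsOpen U) (hf : ContMDiffOn 𝓘(ℂ, E') 𝓘(ℂ, E) ω f U)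
    (hz₀ : z₀ ∈ (chartAt E' q).target) (hz₀U : (chartAt E' q).symm z₀ ∈ U)
    (hp : f ((chartAt E' q).symm z₀) ∈ (chartAt E p).source) :
    oneFormInChart (pullOneForm (E' := E') f α) q =ᶠ[𝓝 z₀] fun z =>
      (oneFormInChart α p (localRep E E' f q p z)).comp (fderiv ℝ (localRep E E' f q p) z) := by
  filter_upwards [eventually_localRep hU hf hz₀ hz₀U hp] with z hz
  have hinv : (chartAt E p).symm (localRep E E' f q p z) = f ((chartAt E' q).symm z) :=
    (chartAt E p).left_inv hz.2.2
  rw [oneFormInChart, oneFormInChart, pullOneForm, hinv, ContinuousLinearMap.comp_assoc,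
    tdiff_comp_chartSymmDiff hU hf hz.1 hz.2.1 hz.2.2, ContinuousLinearMap.comp_assoc]

/-- Reduces pullback on manifolds to pullback between vector spaces. The chart at `p` need only
contain the image point, so smoothness can be tested in any chart at `q`. The equality holds near
`z₀`, not just at it, so it may be differentiated. -/
theorem formInChart_pullForm {k : ℕ} (η : X → E [⋀^Fin k]→L[ℝ] ℝ)
    (hU : IsOpen U) (hf : ContMDiffOn 𝓘(ℂ, E') 𝓘(ℂ, E) ω f U)
    (hz₀ : z₀ ∈ (chartAt E' q).target) (hz₀U : (chartAt E' q).symm z₀ ∈ U)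
    (hp : f ((chartAt E' q).symm z₀) ∈ (chartAt E p).source) :
    formInChart (pullForm (E' := E') f η) q =ᶠ[𝓝 z₀] fun z =>
      (formInChart η p (localRep E E' f q p z)).compContinuousLinearMap
        (fderiv ℝ (localRep E E' f q p) z) := by
  filter_upwards [eventually_localRep hU hf hz₀ hz₀U hp] with z hz
  have hinv : (chartAt E p).symm (localRep E E' f q p z) = f ((chartAt E' q).symm z) :=
    (chartAt E p).left_inv hz.2.2
  have hd := tdiff_comp_chartSymmDiff hU hf hz.1 hz.2.1 hz.2.2
  rw [formInChart, formInChart, pullForm, hinv]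
  ext v
  simp only [ContinuousAlternatingMap.compContinuousLinearMap_apply]
  congr 1
  ext i
  exact DFunLike.congr_fun hd (v i)

/-- The tangent spaces at `q` and `f q` are identified with the models through precisely these two
preferred charts, so no transition derivative appears. -/
theorem fderiv_localRep_self (hU : IsOpen U) (hf : ContMDiffOn 𝓘(ℂ, E') 𝓘(ℂ, E) ω f U)
    (hq : q ∈ U) :
    fderiv ℝ (localRep E E' f q (f q)) (chartAt E' q q) =
      (tdiff (E := E') (E' := E) f q).restrictScalars ℝ := by
  have hsymm : (chartAt E' q).symm (chartAt E' q q) = q :=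
    (chartAt E' q).left_inv (mem_chart_source E' q)
  have hrep : DifferentiableAt ℂ (localRep E E' f q (f q)) (chartAt E' q q) :=
    (contDiffAt_localRep hU hf (mem_chart_target E' q) (by rwa [hsymm])
      (by rw [hsymm]; exact mem_chart_source E _)).differentiableAt (by simp)
  have hfd : MDifferentiableAt 𝓘(ℂ, E') 𝓘(ℂ, E) f q :=
    ((hf _ hq).contMDiffAt (hU.mem_nhds hq)).mdifferentiableAt (by simp)
  rw [hrep.fderiv_restrictScalars ℝ, tdiff, hfd.mfderiv]
  simp only [modelWithCornersSelf_coe, Set.range_id, fderivWithin_univ]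
  rfl

/-- Smoothness of the pullback of a form on a finite-dimensional space. -/
theorem _root_.ContDiffAt.compContinuousLinearMap_alternating
    {F G : Type*} [NormedAddCommGroup F] [NormedSpace ℝ F]
    [NormedAddCommGroup G] [NormedSpace ℝ G] {W : Type*} [NormedAddCommGroup W] [NormedSpace ℝ W]
    [FiniteDimensional ℝ F] {k : ℕ} {n : WithTop ℕ∞} {w₀ : W}
    {a : W → G [⋀^Fin k]→L[ℝ] ℝ} {L : W → F →L[ℝ] G}
    (ha : ContDiffAt ℝ n a w₀) (hL : ContDiffAt ℝ n L w₀) :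
    ContDiffAt ℝ n (fun w => (a w).compContinuousLinearMap (L w)) w₀ := by
  -- An alternating form is determined by its values on tuples of basis vectors. The evaluation map
  -- `ev` is thus injective, and a linear left inverse `P`, continuous by finite dimension, reduces
  -- smoothness to that of each value.
  let b := Module.finBasis ℝ F
  let ev : (F [⋀^Fin k]→L[ℝ] ℝ) →ₗ[ℝ] ((Fin k → Fin (Module.finrank ℝ F)) → ℝ) :=
    { toFun := fun c i => c fun j => b (i j)
      map_add' := fun _ _ => rfl
      map_smul' := fun _ _ => rfl }
  have hinj : LinearMap.ker ev = ⊥ := by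
    rw [LinearMap.ker_eq_bot]
    intro c d hcd
    apply ContinuousAlternatingMap.toAlternatingMap_injective
    apply Module.Basis.ext_alternating b
    intro i _
    exact congrFun hcd i
  obtain ⟨P, hP⟩ := ev.exists_leftInverse_of_injective hinj
  have key : ContDiffAt ℝ n (fun w => ev ((a w).compContinuousLinearMap (L w))) w₀ := by
    rw [contDiffAt_pi]
    intro i
    let T : (G [⋀^Fin k]→L[ℝ] ℝ) →L[ℝ] ContinuousMultilinearMap ℝ (fun _ : Fin k => G) ℝ :=
      ContinuousAlternatingMap.toContinuousMultilinearMapCLM ℝ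
    have h1 : ContDiffAt ℝ n (fun w =>
        (ContinuousMultilinearMap.compContinuousLinearMapContinuousMultilinear
          ℝ (fun _ : Fin k => F) (fun _ : Fin k => G) ℝ (fun _ => L w) (T (a w)))) w₀ :=
      ContDiffAt.clm_apply ((ContinuousMultilinearMap.contDiff _).contDiffAt.comp w₀
          (contDiffAt_pi.2 fun _ => hL))
        (T.contDiff.contDiffAt.comp w₀ ha)
    exact ((ContinuousMultilinearMap.apply ℝ (fun _ : Fin k => F) ℝ
      fun j => b (i j)).contDiff.contDiffAt).comp w₀ h1
  have hcomp := (P.toContinuousLinearMap.contDiff.contDiffAt (n := n)).comp w₀ key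
  refine hcomp.congr_of_eventuallyEq (Filter.Eventually.of_forall fun w => ?_)
  exact (LinearMap.congr_fun hP _).symm

theorem contDiffAt_formInChart_pullForm [FiniteDimensional ℂ E'] {k : ℕ}
    {η : X → E [⋀^Fin k]→L[ℝ] ℝ} (hη : IsSmoothForm η)
    (hU : IsOpen U) (hf : ContMDiffOn 𝓘(ℂ, E') 𝓘(ℂ, E) ω f U)
    (hz₀ : z₀ ∈ (chartAt E' q).target) (hz₀U : (chartAt E' q).symm z₀ ∈ U) :
    ContDiffAt ℝ ∞ (formInChart (pullForm (E' := E') f η) q) z₀ := by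
  have hp := mem_chart_source E (f ((chartAt E' q).symm z₀))
  have : FiniteDimensional ℝ E' := FiniteDimensional.complexToReal E'
  have hrep := contDiffAt_real_localRep hU hf hz₀ hz₀U hp
  refine ContDiffAt.congr_of_eventuallyEq ?_ (formInChart_pullForm η hU hf hz₀ hz₀U hp)
  have htarget := (chartAt E (f ((chartAt E' q).symm z₀))).map_source hp
  refine ContDiffAt.compContinuousLinearMap_alternating ?_ (hrep.fderiv_right (m := ∞) (by simp))
  exact ((hη _ _ htarget).contDiffAt
    ((chartAt E _).open_target.mem_nhds htarget)).comp z₀ hrep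

/-- Naturality of d for the chartwise exterior derivative. The set `U` is there so that it applies
to local sections of a covering, which are holomorphic only on an open set. -/
theorem extD_pullForm {k : ℕ} {η : X → E [⋀^Fin k]→L[ℝ] ℝ} (hη : IsSmoothForm η)
    (hU : IsOpen U) (hf : ContMDiffOn 𝓘(ℂ, E') 𝓘(ℂ, E) ω f U) (hq : q ∈ U) :
    extD (pullForm (E' := E') f η) q = (extD η (f q)).compContinuousLinearMap
      ((tdiff (E := E') (E' := E) f q).restrictScalars ℝ) := by
  have hsymm : (chartAt E' q).symm (chartAt E' q q) = q :=
    (chartAt E' q).left_inv (mem_chart_source E' q)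
  have hp : f ((chartAt E' q).symm (chartAt E' q q)) ∈ (chartAt E (f q)).source := by
    rw [hsymm]; exact mem_chart_source E _
  have hqU : (chartAt E' q).symm (chartAt E' q q) ∈ U := by rwa [hsymm]
  have hrep := contDiffAt_real_localRep hU hf (mem_chart_target E' q) hqU hp
  have hval : localRep E E' f q (f q) (chartAt E' q q) = chartAt E (f q) (f q) := by
    rw [localRep, hsymm]
  have hd : DifferentiableAt ℝ (formInChart η (f q))
      (localRep E E' f q (f q) (chartAt E' q q)) := by
    rw [hval]
    exact ((hη _ _ (mem_chart_target E _)).contDiffAt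
      ((chartAt E _).open_target.mem_nhds (mem_chart_target E _))).differentiableAt (by simp)
  rw [extD, (formInChart_pullForm η hU hf (mem_chart_target E' q) hqU hp).extDeriv_eq,
    extDeriv_pullback hd hrep
      (by simpa using (WithTop.coe_le_coe.2 (le_top : (2 : ℕ∞) ≤ ⊤))), hval, fderiv_localRep_self hU hf hq, extD]

end LocalRepresentative

/-! ### Functoriality of the pullback of Higgs bundles -/

section PullbackOfHiggsBundles

variable {E : Type*} [NormedAddCommGroup E] [NormedSpace ℂ E]
  {X : Type*} [TopologicalSpace X] [ChartedSpace E X]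
  {E' : Type*} [NormedAddCommGroup E'] [NormedSpace ℂ E']
  {Y : Type*} [TopologicalSpace Y] [ChartedSpace E' Y]
  {E'' : Type*} [NormedAddCommGroup E''] [NormedSpace ℂ E'']
  {Z : Type*} [TopologicalSpace Z] [ChartedSpace E'' Z]

theorem tdiff_comp {g : Y → X} {f : Z → Y} {z : Z}
    (hg : MDifferentiableAt 𝓘(ℂ, E') 𝓘(ℂ, E) g (f z))
    (hf : MDifferentiableAt 𝓘(ℂ, E'') 𝓘(ℂ, E') f z) :
    tdiff (E := E'') (E' := E) (g ∘ f) z =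
      (tdiff (E := E') (E' := E) g (f z)).comp (tdiff (E := E'') (E' := E') f z) :=
  mfderiv_comp z hg hf

theorem HiggsBundle.ext_φ {r : ℕ} {B : HolBundle E X r} {φ φ' : B.ι → X → E →L[ℂ] EndFib r}
    (h : φ = φ') {h₁ h₂ h₃ h₁' h₂' h₃'} :
    (⟨B, φ, h₁, h₂, h₃⟩ : HiggsBundle E X r) = ⟨B, φ', h₁', h₂', h₃'⟩ := by
  subst h; rfl

/-- A true equality rather than an isomorphism: cocycles are pulled back by precomposition, so the
underlying bundles agree definitionally. Only the Higgs fields need an argument, the chain rule. -/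
theorem HiggsBundle.pullback_pullback [IsManifold 𝓘(ℂ, E) ω X] [IsManifold 𝓘(ℂ, E') ω Y]
    [IsManifold 𝓘(ℂ, E'') ω Z] {r : ℕ} (H : HiggsBundle E X r) (g : Y → X)
    (hg : IsMorphism E' E g) (f : Z → Y) (hf : IsMorphism E'' E' f) :
    (H.pullback g hg).pullback f hf = H.pullback (g ∘ f) (hg.comp hf) := by
  refine HiggsBundle.ext_φ (funext fun i => funext fun z => ?_)
  rw [tdiff_comp (hg.contMDiffAt.mdifferentiableAt (by simp))
    (hf.contMDiffAt.mdifferentiableAt (by simp))]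
  rfl

end PullbackOfHiggsBundles

/-! ### Naturality of connections, curvature and the discriminant form -/

section PullbackOfConnections

/-- The antisymmetrized derivative of a one-form commutes with pullback. -/
theorem antisymm_fderiv_pullback {F G V : Type*} [NormedAddCommGroup F] [NormedSpace ℝ F]
    [NormedAddCommGroup G] [NormedSpace ℝ G] [NormedAddCommGroup V] [NormedSpace ℝ V]
    {a : G → G →L[ℝ] V} {τ : F → G} {z : F} (ha : DifferentiableAt ℝ a (τ z))
    (hτ : ContDiffAt ℝ ∞ τ z) (v w : F) :
    fderiv ℝ (fun y => (a (τ y)).comp (fderiv ℝ τ y)) z v w -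
        fderiv ℝ (fun y => (a (τ y)).comp (fderiv ℝ τ y)) z w v =
      fderiv ℝ a (τ z) (fderiv ℝ τ z v) (fderiv ℝ τ z w) -
        fderiv ℝ a (τ z) (fderiv ℝ τ z w) (fderiv ℝ τ z v) := by
  have h2 : (2 : WithTop ℕ∞) ≤ ∞ := WithTop.coe_le_coe.2 (le_top : (2 : ℕ∞) ≤ ⊤)
  have hτd : DifferentiableAt ℝ τ z := hτ.differentiableAt (by simp)
  have hτ' : DifferentiableAt ℝ (fderiv ℝ τ) z :=
    (hτ.fderiv_right (m := ∞) (by simp)).differentiableAt (by simp)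
  have hsymm : IsSymmSndFDerivAt ℝ τ z := hτ.isSymmSndFDerivAt (by simpa using h2)
  have haτ : HasFDerivAt (fun y => a (τ y)) ((fderiv ℝ a (τ z)).comp (fderiv ℝ τ z)) z :=
    ha.hasFDerivAt.comp z hτd.hasFDerivAt
  -- The product rule adds a term `a (τ z)` applied to the second derivative of `τ`; it is symmetric
  -- in `v` and `w`, so it cancels.
  rw [(haτ.clm_comp hτ'.hasFDerivAt).fderiv]
  simp [hsymm.eq v w]

variable {E : Type*} [NormedAddCommGroup E] [NormedSpace ℂ E]
  {X : Type*} [TopologicalSpace X] [ChartedSpace E X]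
  {E' : Type*} [NormedAddCommGroup E'] [NormedSpace ℂ E']
  {Y : Type*} [TopologicalSpace Y] [ChartedSpace E' Y]
  [IsManifold 𝓘(ℂ, E) ω X] [IsManifold 𝓘(ℂ, E') ω Y]

/-- The pullback of a connection along a morphism. -/
noncomputable def HolBundle.Connection.pullback {r : ℕ} {B : HolBundle E X r} (D : B.Connection)
    (f : Y → X) (hf : IsMorphism E' E f) : (B.pullback f hf).Connection where
  A := fun i => pullOneForm f (D.A i)
  smooth := by
    rintro i q z₀ ⟨hz₀, hz₀U⟩
    have hp := mem_chart_source E (f ((chartAt E' q).symm z₀))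
    have hf' : ContMDiffOn 𝓘(ℂ, E') 𝓘(ℂ, E) ω f Set.univ := hf.contMDiffOn
    have hrep := contDiffAt_real_localRep isOpen_univ hf' hz₀ (Set.mem_univ _) hp
    refine (ContDiffAt.congr_of_eventuallyEq ?_ (oneFormInChart_pullOneForm (D.A i) isOpen_univ hf'
      hz₀ (Set.mem_univ _) hp)).contDiffWithinAt
    refine ContDiffAt.clm_comp ?_ (hrep.fderiv_right (m := ∞) (by simp))
    have hmem : localRep E E' f q (f ((chartAt E' q).symm z₀)) z₀ ∈
        (chartAt E (f ((chartAt E' q).symm z₀))).target ∩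
          (chartAt E (f ((chartAt E' q).symm z₀))).symm ⁻¹' B.core.baseSet i := by
      refine ⟨(chartAt E _).map_source hp, ?_⟩
      rw [Set.mem_preimage, localRep, (chartAt E _).left_inv hp]
      exact hz₀U
    exact ((D.smooth i _ _ hmem).contDiffAt (((chartAt E _).isOpen_inter_preimage_symm
      (B.core.isOpen_baseSet i)).mem_nhds hmem)).comp z₀ hrep
  glue := by
    intro i j y hy v
    have hopen := (B.core.isOpen_baseSet i).inter (B.core.isOpen_baseSet j)
    have hgd : MDifferentiableAt 𝓘(ℂ, E) 𝓘(ℂ, EndFib r) (B.core.coordChange i j) (f y) :=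
      ((B.holomorphic.contMDiffOn_coordChange i j _ hy).contMDiffAt
        (hopen.mem_nhds hy)).mdifferentiableAt (by simp)
    have h := tdiff_comp hgd (hf.contMDiffAt.mdifferentiableAt (x := y) (by simp))
    have h' := D.glue i j (f y) hy (tdiff (E := E') (E' := E) f y v)
    have hv := DFunLike.congr_fun h v
    exact (congrArg (· + _) hv).trans h'

namespace HolBundle.Connection

variable {r : ℕ} {B : HolBundle E X r} (D : B.Connection) {f : Y → X} (hf : IsMorphism E' E f)

/-- The trivialization chosen at `q` for the pulled-back bundle is the one chosen at `f q` for `B`,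
so no change of gauge intervenes. The dA part is `antisymm_fderiv_pullback`; the A ∧ A part is
pointwise. -/
theorem curvature_pullback (q : Y) (v w : E') :
    (D.pullback f hf).curvature q v w =
      D.curvature (f q) (tdiff (E := E') (E' := E) f q v) (tdiff (E := E') (E' := E) f q w) := by
  have hf' : ContMDiffOn 𝓘(ℂ, E') 𝓘(ℂ, E) ω f Set.univ := hf.contMDiffOn
  have hsymm : (chartAt E' q).symm (chartAt E' q q) = q :=
    (chartAt E' q).left_inv (mem_chart_source E' q)
  have hp : f ((chartAt E' q).symm (chartAt E' q q)) ∈ (chartAt E (f q)).source := by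
    rw [hsymm]; exact mem_chart_source E _
  have hrep := contDiffAt_real_localRep isOpen_univ hf' (mem_chart_target E' q)
    (Set.mem_univ _) hp
  have hval : localRep E E' f q (f q) (chartAt E' q q) = chartAt E (f q) (f q) := by
    rw [localRep, hsymm]
  have hmem : chartAt E (f q) (f q) ∈ (chartAt E (f q)).target ∩
      (chartAt E (f q)).symm ⁻¹' B.core.baseSet (B.core.indexAt (f q)) := by
    refine ⟨mem_chart_target E _, ?_⟩
    rw [Set.mem_preimage, (chartAt E _).left_inv (mem_chart_source E _)]
    exact B.core.mem_baseSet_at (f q)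
  have hd : DifferentiableAt ℝ (oneFormInChart (D.A (B.core.indexAt (f q))) (f q))
      (localRep E E' f q (f q) (chartAt E' q q)) := by
    rw [hval]
    exact ((D.smooth _ _ _ hmem).contDiffAt (((chartAt E _).isOpen_inter_preimage_symm
      (B.core.isOpen_baseSet _)).mem_nhds hmem)).differentiableAt (by simp)
  have hform := oneFormInChart_pullOneForm (D.A (B.core.indexAt (f q))) isOpen_univ hf'
    (mem_chart_target E' q) (Set.mem_univ _) hp
  have hanti := antisymm_fderiv_pullback hd hrep v w
  have hT := fderiv_localRep_self isOpen_univ hf' (Set.mem_univ q)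
  rw [← hform.fderiv_eq, hval, hT] at hanti
  have hpt := hform.self_of_nhds
  simp only [hval, hT] at hpt
  change fderiv ℝ (oneFormInChart (pullOneForm (E' := E') f (D.A (B.core.indexAt (f q)))) q)
      (chartAt E' q q) v w - fderiv ℝ (oneFormInChart (pullOneForm (E' := E') f
        (D.A (B.core.indexAt (f q)))) q) (chartAt E' q q) w v +
      (oneFormInChart (pullOneForm (E' := E') f (D.A (B.core.indexAt (f q)))) q
          (chartAt E' q q) v *
        oneFormInChart (pullOneForm (E' := E') f (D.A (B.core.indexAt (f q)))) q
          (chartAt E' q q) w -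
        oneFormInChart (pullOneForm (E' := E') f (D.A (B.core.indexAt (f q)))) q
          (chartAt E' q q) w *
        oneFormInChart (pullOneForm (E' := E') f (D.A (B.core.indexAt (f q)))) q
          (chartAt E' q q) v) = _
  rw [hanti, hpt]
  rfl

theorem discriminantForm_pullback (q : Y) (v : Fin 4 → E') :
    (D.pullback f hf).discriminantForm q v =
      D.discriminantForm (f q) (fun i => tdiff (E := E') (E' := E) f q (v i)) := by
  simp only [discriminantForm, c₂, c₁, wedge, curvature_pullback]

end HolBundle.Connection

end PullbackOfConnections

/-! ### Averaging forms over the fibres of a finite étale map -/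

section Pushforward

variable {E : Type*} [NormedAddCommGroup E] [NormedSpace ℂ E]
  {X : Type*} [TopologicalSpace X] [ChartedSpace E X]
  {E' : Type*} [NormedAddCommGroup E'] [NormedSpace ℂ E']
  {Y : Type*} [TopologicalSpace Y] [ChartedSpace E' Y] {g : Y → X}

/-- A continuous local section of a local biholomorphism is holomorphic. -/
theorem contMDiffOn_of_continuousOn_section (hg : IsLocalDiffeomorph 𝓘(ℂ, E') 𝓘(ℂ, E) ω g)
    {V : Set X} (hV : IsOpen V) {s : X → Y} (hs : ContinuousOn s V)
    (hgs : ∀ x ∈ V, g (s x) = x) : ContMDiffOn 𝓘(ℂ, E) 𝓘(ℂ, E') ω s V := by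
  intro x hx
  obtain ⟨Φ, hΦ, hgΦ⟩ := hg (s x)
  have hxt : x ∈ Φ.target := by
    have h := Φ.map_source hΦ
    have h' := hgΦ hΦ
    rw [hgs x hx] at h'
    rw [h']
    exact h
  -- By continuity `s` stays in the source of `Φ` near `x`, where `g` is injective, so it must be
  -- the local inverse.
  have heq : s =ᶠ[𝓝 x] Φ.invFun := by
    filter_upwards [hV.mem_nhds hx,
      (hs.continuousAt (hV.mem_nhds hx)).eventually_mem (Φ.open_source.mem_nhds hΦ)] with w hw hws
    have h := hgΦ hws
    rw [hgs w hw] at h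
    have h' : Φ.invFun (Φ.toFun (s w)) = s w := Φ.left_inv hws
    have h'' : w = Φ.toFun (s w) := h
    rw [← h''] at h'
    exact h'.symm
  have hinv : ContMDiffAt 𝓘(ℂ, E) 𝓘(ℂ, E') ω Φ.invFun x :=
    (Φ.contMDiffOn_invFun x hxt).contMDiffAt (Φ.open_target.mem_nhds hxt)
  exact (hinv.congr_of_eventuallyEq heq).contMDiffWithinAt

/-- Holomorphic local sections enumerating the fibres of a finite étale map near a point. -/
theorem IsFiniteEtale.exists_sections [T2Space Y] (hg : IsFiniteEtale E' E g) (x₀ : X) :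
    ∃ (V : Set X) (s : g ⁻¹' {x₀} → X → Y), IsOpen V ∧ x₀ ∈ V ∧
      (∀ i, ContMDiffOn 𝓘(ℂ, E) 𝓘(ℂ, E') ω (s i) V) ∧ (∀ i, ∀ x ∈ V, g (s i x) = x) ∧
      ∀ x ∈ V, Function.Injective (fun i => s i x) ∧ Set.range (fun i => s i x) = g ⁻¹' {x} := by
  classical
  -- A closed local homeomorphism with finite fibres and Hausdorff source is a covering.
  have hcov : IsCoveringMapOn g Set.univ :=
    hg.proper.isClosedMap.isCoveringMapOn_of_isLocalHomeomorphOn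
      (fun x _ => hg.finite_fibres x) (hg.etale.isLocalHomeomorph.isLocalHomeomorphOn)
  obtain ⟨_, V, hx₀, hV, -, H, hH⟩ := hcov x₀ (Set.mem_univ _)
  have hgH : ∀ (x : V) (i : g ⁻¹' {x₀}), g (H.symm (x, i)) = x := fun x i => by
    have := hH (H.symm (x, i))
    rw [H.apply_symm_apply] at this
    exact this.symm
  -- The sheets over `V` are indexed by the fibre over `x₀`; the value outside `V` is arbitrary.
  let s : g ⁻¹' {x₀} → X → Y := fun i x => if hx : x ∈ V then H.symm (⟨x, hx⟩, i) else i
  have hs : ∀ i x (hx : x ∈ V), s i x = H.symm (⟨x, hx⟩, i) := fun i x hx => dif_pos hx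
  have hgs : ∀ i, ∀ x ∈ V, g (s i x) = x := fun i x hx => by rw [hs i x hx, hgH]
  refine ⟨V, s, hV, hx₀, fun i => ?_, hgs, fun x hx => ⟨fun i j hij => ?_, ?_⟩⟩
  · refine contMDiffOn_of_continuousOn_section hg.etale hV ?_ (hgs i)
    rw [continuousOn_iff_continuous_domRestrict]
    have hc : Continuous fun x : V => (H.symm (x, i) : Y) :=
      continuous_subtype_val.comp (H.symm.continuous.comp (by fun_prop))
    exact hc.congr fun x => (hs i x x.2).symm
  · simp only [hs _ x hx] at hij
    exact (Prod.ext_iff.1 (H.symm.injective (Subtype.ext hij))).2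
  · apply Set.Subset.antisymm
    · rintro _ ⟨i, rfl⟩
      exact hgs i x hx
    · intro y hy
      have hyV : y ∈ g ⁻¹' V := by
        have : g y = x := hy
        rw [Set.mem_preimage, this]; exact hx
      refine ⟨(H ⟨y, hyV⟩).2, ?_⟩
      have h1 : (H ⟨y, hyV⟩).1 = ⟨x, hx⟩ := Subtype.ext ((hH _).trans hy)
      simp only [hs _ x hx]
      rw [← h1]
      simp

/-- The image is closed because `g` is proper and open because `g` is étale. -/
theorem IsFiniteEtale.surjective [ConnectedSpace X] [Nonempty Y] (hg : IsFiniteEtale E' E g) :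
    Function.Surjective g := by
  rw [← Set.range_eq_univ]
  exact IsClopen.eq_univ ⟨hg.proper.isClosedMap.isClosed_range, hg.etale.isOpen_range⟩
    (Set.range_nonempty g)

/-- The average over the fibres of `g` of a differential form. -/
noncomputable def fibreAverage {k : ℕ} (g : Y → X) (η : Y → E' [⋀^Fin k]→L[ℝ] ℝ) (x : X) :
    E [⋀^Fin k]→L[ℝ] ℝ :=
  -- Inverting the differential of `g` carries each `η y` to `x` without choosing local sections, so
  -- the form is globally defined from the start.
  ((g ⁻¹' {x}).ncard : ℝ)⁻¹ • ∑ᶠ y ∈ g ⁻¹' {x},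
    (η y).compContinuousLinearMap ((tdiff (E := E') (E' := E) g y).inverse.restrictScalars ℝ)

variable {x₀ : X} {V : Set X} {s : g ⁻¹' {x₀} → X → Y}

/-- Differentiate g ∘ s = id; the differential of `g` is already invertible, so a right inverse is
the inverse. -/
theorem IsFiniteEtale.inverse_tdiff (hg : IsFiniteEtale E' E g) (hV : IsOpen V) {s : X → Y}
    (hs : ContMDiffOn 𝓘(ℂ, E) 𝓘(ℂ, E') ω s V) (hgs : ∀ x ∈ V, g (s x) = x) {x : X} (hx : x ∈ V) :
    (tdiff (E := E') (E' := E) g (s x)).inverse = tdiff (E := E) (E' := E') s x := by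
  let L : E' ≃L[ℂ] E := (hg.etale (s x)).mfderivToContinuousLinearEquiv (by simp)
  have hL : tdiff (E := E') (E' := E) g (s x) = L := rfl
  have hcomp := tdiff_comp (hg.isMorphism.contMDiffAt.mdifferentiableAt (x := s x) (by simp))
    (((hs x hx).contMDiffAt (hV.mem_nhds hx)).mdifferentiableAt (by simp))
  have hid : g ∘ s =ᶠ[𝓝 x] id := by
    filter_upwards [hV.mem_nhds hx] with w hw using hgs w hw
  have hone : tdiff (E := E) (E' := E) (g ∘ s) x = ContinuousLinearMap.id ℂ E :=
    (hid.mfderiv_eq (I := 𝓘(ℂ, E)) (I' := 𝓘(ℂ, E))).trans mfderiv_id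
  rw [hone, hL] at hcomp
  rw [hL, ContinuousLinearMap.inverse_equiv]
  ext v
  apply L.injective
  rw [ContinuousLinearEquiv.coe_coe, L.apply_symm_apply]
  exact DFunLike.congr_fun hcomp v

/-- Over `V` the sections enumerate each fibre once, so the number of sheets is constant and the
normalizing factor can be treated as a constant under d. -/
theorem IsFiniteEtale.fibreAverage_eq (hg : IsFiniteEtale E' E g) [Fintype (g ⁻¹' {x₀})]
    (hV : IsOpen V) (hs : ∀ i, ContMDiffOn 𝓘(ℂ, E) 𝓘(ℂ, E') ω (s i) V)
    (hgs : ∀ i, ∀ x ∈ V, g (s i x) = x)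
    (hfib : ∀ x ∈ V, Function.Injective (fun i => s i x) ∧
      Set.range (fun i => s i x) = g ⁻¹' {x}) {k : ℕ} (η : Y → E' [⋀^Fin k]→L[ℝ] ℝ)
    {x : X} (hx : x ∈ V) :
    fibreAverage g η x =
      (Fintype.card (g ⁻¹' {x₀}) : ℝ)⁻¹ • ∑ i, pullForm (E' := E) (s i) η x := by
  obtain ⟨hinj, hrange⟩ := hfib x hx
  rw [fibreAverage, ← hrange, finsum_mem_range hinj, finsum_eq_sum_of_fintype,
    ← Set.image_univ, Set.ncard_image_of_injective _ hinj, Set.ncard_univ,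
    Nat.card_eq_fintype_card]
  congr 1
  refine Finset.sum_congr rfl fun i _ => ?_
  rw [hg.inverse_tdiff hV (hs i) (hgs i) hx]
  rfl

theorem IsFiniteEtale.formInChart_fibreAverage (hg : IsFiniteEtale E' E g)
    [Fintype (g ⁻¹' {x₀})]
    (hV : IsOpen V) (hs : ∀ i, ContMDiffOn 𝓘(ℂ, E) 𝓘(ℂ, E') ω (s i) V)
    (hgs : ∀ i, ∀ x ∈ V, g (s i x) = x)
    (hfib : ∀ x ∈ V, Function.Injective (fun i => s i x) ∧
      Set.range (fun i => s i x) = g ⁻¹' {x}) {k : ℕ} (η : Y → E' [⋀^Fin k]→L[ℝ] ℝ)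
    {p : X} {z₀ : E} (hz₀ : z₀ ∈ (chartAt E p).target) (hz₀V : (chartAt E p).symm z₀ ∈ V) :
    formInChart (fibreAverage g η) p =ᶠ[𝓝 z₀] fun z =>
      (Fintype.card (g ⁻¹' {x₀}) : ℝ)⁻¹ •
        ∑ i, formInChart (pullForm (E' := E) (s i) η) p z := by
  filter_upwards [((chartAt E p).continuousAt_symm hz₀).eventually_mem (hV.mem_nhds hz₀V)]
    with z hz
  rw [formInChart, hg.fibreAverage_eq hV hs hgs hfib η hz]
  ext v
  simp [formInChart]

theorem extDeriv_smul_sum {F ι : Type*} [NormedAddCommGroup F] [NormedSpace ℝ F] [Fintype ι]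
    {k : ℕ} (c : ℝ) {a : ι → F → F [⋀^Fin k]→L[ℝ] ℝ} {z : F}
    (ha : ∀ i, DifferentiableAt ℝ (a i) z) :
    extDeriv (fun y => c • ∑ i, a i y) z = c • ∑ i, extDeriv (a i) z := by
  classical
  have hsum : ∀ t : Finset ι, DifferentiableAt ℝ (fun y => ∑ i ∈ t, a i y) z ∧
      extDeriv (fun y => ∑ i ∈ t, a i y) z = ∑ i ∈ t, extDeriv (a i) z := by
    intro t
    induction t using Finset.induction_on with
    | empty =>
      refine ⟨by simp, ?_⟩
      ext v
      simp [extDeriv, ContinuousAlternatingMap.alternatizeUncurryFin_apply]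
    | insert i t hi ih =>
      simp only [Finset.sum_insert hi]
      exact ⟨(ha i).add ih.1, by rw [extDeriv_fun_add (ha i) ih.1, ih.2]⟩
  rw [← (hsum Finset.univ).2]
  exact extDeriv_fun_smul c _

variable [IsManifold 𝓘(ℂ, E) ω X] [IsManifold 𝓘(ℂ, E') ω Y] [T2Space Y]

theorem IsFiniteEtale.isSmoothForm_fibreAverage [FiniteDimensional ℂ E]
    (hg : IsFiniteEtale E' E g) {k : ℕ} {η : Y → E' [⋀^Fin k]→L[ℝ] ℝ} (hη : IsSmoothForm η) :
    IsSmoothForm (fibreAverage (E := E) g η) := by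
  intro p z₀ hz₀
  obtain ⟨V, s, hV, hmem, hs, hgs, hfib⟩ := hg.exists_sections ((chartAt E p).symm z₀)
  have : Fintype (g ⁻¹' {(chartAt E p).symm z₀}) := (hg.finite_fibres _).fintype
  refine (ContDiffAt.congr_of_eventuallyEq ?_
    (hg.formInChart_fibreAverage hV hs hgs hfib η hz₀ hmem)).contDiffWithinAt
  exact ContDiffAt.const_smul (Fintype.card (g ⁻¹' {(chartAt E p).symm z₀}) : ℝ)⁻¹
    (ContDiffAt.sum fun i _ => contDiffAt_formInChart_pullForm hη hV (hs i) hz₀ hmem)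

/-- Injectivity of pullback on cohomology: the fibre average of a primitive of g^*Ω is a primitive
of Ω. -/
theorem IsFiniteEtale.isExactFourForm_of_pullback [FiniteDimensional ℂ E] [ConnectedSpace X]
    [Nonempty Y] (hg : IsFiniteEtale E' E g) {Ω : X → (Fin 4 → E) → ℝ}
    (hΩ : IsExactFourForm (E := E') fun y v =>
      Ω (g y) fun i => tdiff (E := E') (E' := E) g y (v i)) :
    IsExactFourForm Ω := by
  obtain ⟨η, hη, hdη⟩ := hΩ
  refine ⟨fibreAverage g η, hg.isSmoothForm_fibreAverage hη, fun p v => ?_⟩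
  obtain ⟨V, s, hV, hmem, hs, hgs, hfib⟩ := hg.exists_sections p
  have : Fintype (g ⁻¹' {p}) := (hg.finite_fibres _).fintype
  -- Surjectivity makes the number of sheets nonzero, so that dividing by it is legitimate.
  have : Nonempty (g ⁻¹' {p}) := let ⟨y, hy⟩ := hg.surjective p; ⟨⟨y, hy⟩⟩
  have hsymm : (chartAt E p).symm (chartAt E p p) = p :=
    (chartAt E p).left_inv (mem_chart_source E p)
  have hmem' : (chartAt E p).symm (chartAt E p p) ∈ V := by rwa [hsymm]
  have hterm : ∀ i, extD (pullForm (E' := E) (s i) η) p v = Ω p v := by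
    intro i
    rw [extD_pullForm hη hV (hs i) hmem, ContinuousAlternatingMap.compContinuousLinearMap_apply,
      hdη]
    beta_reduce
    rw [hgs i p hmem]
    congr 1
    ext j
    -- The vectors fed to Ω are dg(ds_i(v j)), and ds_i is the inverse of dg.
    let L : E' ≃L[ℂ] E := (hg.etale (s i p)).mfderivToContinuousLinearEquiv (by simp)
    have hL : tdiff (E := E') (E' := E) g (s i p) = L := rfl
    rw [← hg.inverse_tdiff hV (hs i) (hgs i) hmem, hL, ContinuousLinearMap.inverse_equiv]
    exact L.apply_symm_apply (v j)
  rw [extD, (hg.formInChart_fibreAverage hV hs hgs hfib η (mem_chart_target E p)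
    hmem').extDeriv_eq, extDeriv_smul_sum _ fun i => (contDiffAt_formInChart_pullForm hη hV (hs i)
      (mem_chart_target E p) hmem').differentiableAt (by simp)]
  have hsum : (∑ i, extDeriv (formInChart (pullForm (E' := E) (s i) η) p) (chartAt E p p)) v =
      ∑ _i : g ⁻¹' {p}, Ω p v := by
    rw [ContinuousAlternatingMap.sum_apply]
    exact Finset.sum_congr rfl fun i _ => hterm i
  rw [ContinuousAlternatingMap.smul_apply, hsum]
  have hcard : (Fintype.card (g ⁻¹' {p}) : ℝ) ≠ 0 := by exact_mod_cast Fintype.card_ne_zero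
  rw [Finset.sum_const, Finset.card_univ, nsmul_eq_mul, smul_eq_mul, inv_mul_cancel_left₀ hcard]

end Pushforward

end HiggsVar

/-! ### Descent of the Higgs variety property -/

theorem mainTheorem6
    {EX : Type*} [NormedAddCommGroup EX] [NormedSpace ℂ EX]
    {X : Type*} [TopologicalSpace X] [ChartedSpace EX X] [HiggsVar.SmoothProjectiveVariety EX X]
    {EY : Type*} [NormedAddCommGroup EY] [NormedSpace ℂ EY]
    {Y : Type*} [TopologicalSpace Y] [ChartedSpace EY Y] [HiggsVar.SmoothProjectiveVariety EY Y]
    (g : Y → X) (hg : HiggsVar.IsFiniteEtale EY EX g)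
    (hY : HiggsVar.IsHiggsVariety EY Y) :
    HiggsVar.IsHiggsVariety EX X := by
  have : FiniteDimensional ℂ EX :=
    HiggsVar.SmoothProjectiveVariety.finiteDimensional (E := EX) (X := X)
  have : ConnectedSpace X := HiggsVar.SmoothProjectiveVariety.connectedSpace (E := EX)
  have : ConnectedSpace Y := HiggsVar.SmoothProjectiveVariety.connectedSpace (E := EY)
  have : T2Space Y := HiggsVar.SmoothProjectiveVariety.t2Space (E := EY)
  obtain ⟨y₀⟩ : Nonempty Y := inferInstance
  -- The differential of an étale map at one point identifies the model spaces, hence the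
  -- dimensions.
  let L : EY ≃L[ℂ] EX := (hg.etale y₀).mfderivToContinuousLinearEquiv (by simp)
  have hdim : Module.finrank ℂ EY = Module.finrank ℂ EX := L.toLinearEquiv.finrank_eq
  rcases hY with hY | ⟨hdimY, hY⟩
  · exact Or.inl (hdim ▸ hY)
  refine Or.inr ⟨hdim ▸ hdimY, fun r H hH D => ?_⟩
  apply hg.isExactFourForm_of_pullback
  have hss := hY r (H.pullback g hg.isMorphism) (by
    intro C _ _ _ f hf
    rw [HiggsVar.HiggsBundle.pullback_pullback]
    exact hH C (g ∘ f) (hg.isMorphism.comp hf))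
  -- Vanishing of the discriminant is a statement about every connection, so it can be used for g^*D
  -- itself; independence of the class from the connection is not needed.
  have hexact := hss (D.pullback g hg.isMorphism)
  have hform : (D.pullback g hg.isMorphism).discriminantForm = fun y v =>
      D.discriminantForm (g y) fun i => HiggsVar.tdiff (E := EY) (E' := EX) g y (v i) :=
    funext fun y => funext fun v => D.discriminantForm_pullback hg.isMorphism y v
  rw [← hform]
  exact hexact
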